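/- A seller offers $K\ge 1$ indivisible goods, produced at zero cost, to a buyer whose payoff from receiving bundle $B$ and paying $p$ is $\sum_{k\in B}v_k-p$. The value vector $\mathbf v=(v_k)_k\in\mathbb R_+^K$ has an elliptical distribution (for some location vector $m$, positive definite matrix $S$ and scalar function $\psi$, the characteristic function of $\mathbf v-m$ is $t\mapsto\psi(t'St)$) with a density that vanishes outside a compact set $V\subset\mathbb R_+^K$ and is continuous on $V$. Let $\mu_k$ and $\sigma_k$ be the mean and standard deviation of $v_k$, and suppose that $\mathrm{Corr}(v_i,v_j)=\rho\in(-1,1)$ for all $i\ne j$. The buyer and the seller move simultaneously. The buyer chooses $n\le N$ weight vectors $\boldsymbol\alpha_1,\dots,\boldsymbol\alpha_n\in\mathbb R^K$, at no cost, observes $(\boldsymbol\alpha_j\cdot\mathbf v)_{j\le n}$, and has as his type $\boldsymbol\theta$ the conditional expectation of $\mathbf v$ given these signals. Here $N\ge1$ is given; $N=1$ is the game in which only one signal can be acquired. The seller chooses a mechanism $(M,x,p)$ with message space $M$, allocation rule $x:M\to\Delta(2^K)$ and payment rule $p:M\to\mathbb R$, which contains a message giving the empty bundle at price $0$. With $x_k(m)$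 the probability that good $k$ is allocated, the buyer sends a message maximizing $\sum_k\theta_kx_k(m)-p(m)$ and breaks indifferences in favor of the seller. A profile is an equilibrium if the buyer's choice of signals maximizes his expected payoff $\mathbb E\big[\sup_{m}\{\sum_k\theta_kx_k(m)-p(m)\}\big]$ given the mechanism, and the mechanism maximizes expected profit over all mechanisms given the buyer's choice of signals. Suppose that for all $i\ne j$, \[\mu_i=\frac{\sigma_i^2+\rho\,\sigma_i\sum_{k\ne i}\sigma_k}{\sigma_j^2+\rho\,\sigma_j\sum_{k\ne j}\sigma_k}\,\mu_j .\] Then learning the grand bundle value, $\boldsymbol\alpha=\mathbf 1=(1,\dots,1)$, is vertical, i.e. $\mathrm{Cov}(v_k,\mathbf 1\cdot\mathbf v)\ge0$ for every $k$, and there is a price $\pi$ such that, for every $N\ge1$, the profile in which the buyer acquires only the signal $\mathbf 1\cdot\mathbf v$ and the seller offers only the grand bundle, at price $\pi$, is an equilibrium of the game in which the buyer may acquire up to $N$ signals. -/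

import Mathlib

open MeasureTheory ProbabilityTheory

noncomputable section

namespace Bundling

/-- The space `ℝ^K` of value vectors, one coordinate for each good. -/
abbrev Values (K : ℕ) : Type := EuclideanSpace ℝ (Fin K)

/-! ### The distribution of values -/

/-- A law `F` on `ℝ^K` is elliptical: for some location `μ`, positive definite matrix `S` and
scalar function `ψ`, the characteristic function of `v - μ` at `t` is `ψ (tᵀ S t)`. -/
def IsElliptical {K : ℕ} (F : Measure (Values K)) : Prop :=
  ∃ (μ : Values K) (S : Matrix (Fin K) (Fin K) ℝ) (ψ : ℝ → ℂ), S.PosDef ∧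
    ∀ t : Values K,
      charFun (F.map (fun v => v - μ)) t = ψ (dotProduct t.ofLp (S.mulVec t.ofLp))

/-- The law `F` has a density with respect to Lebesgue measure that vanishes outside a compact
set `V` of nonnegative vectors and is continuous on `V`. (The density need not vanish on the
boundary of `V`, so uniform and truncated laws are covered.) -/
def HasContinuousCompactDensity {K : ℕ} (F : Measure (Values K)) : Prop :=
  ∃ (V : Set (Values K)) (f : Values K → ℝ),
    IsCompact V ∧ (∀ v ∈ V, ∀ k, 0 ≤ v k) ∧
    (∀ v, 0 ≤ f v) ∧ ContinuousOn f V ∧ (∀ v, v ∉ V → f v = 0) ∧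
    F = volume.withDensity (fun v => ENNReal.ofReal (f v))

/-- The prior mean `μ_k = E[v_k]`. -/
def mean {K : ℕ} (F : Measure (Values K)) (k : Fin K) : ℝ := ∫ v, v k ∂F

/-- The prior standard deviation `σ_k` of `v_k`. -/
def stdDev {K : ℕ} (F : Measure (Values K)) (k : Fin K) : ℝ :=
  Real.sqrt (variance (fun v : Values K => v k) F)

/-- The correlation coefficient of `v_i` and `v_j`. -/
def corr {K : ℕ} (F : Measure (Values K)) (i j : Fin K) : ℝ :=
  covariance (fun v : Values K => v i) (fun v : Values K => v j) F / (stdDev F i * stdDev F j)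

/-- The standing assumptions on the law of the values, with common correlation `ρ`. -/
structure IsPrior {K : ℕ} (F : Measure (Values K)) (ρ : ℝ) : Prop where
  isProbabilityMeasure : IsProbabilityMeasure F
  elliptical : IsElliptical F
  density : HasContinuousCompactDensity F
  neg_one_lt : -1 < ρ
  lt_one : ρ < 1
  corr_eq : ∀ i j, i ≠ j → corr F i j = ρ

/-! ### Learning -/

/-- The value `α · v` of the linear signal with weights `α`. -/
def linearSignal {K : ℕ} (α : Fin K → ℝ) (v : Values K) : ℝ := ∑ k, α k * v k

/-- The realization of `n` linear signals, the `j`-th one with learning weights `α j`. -/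
def signals {K n : ℕ} (α : Fin n → Fin K → ℝ) (v : Values K) : Fin n → ℝ :=
  fun j => linearSignal (α j) v

/-- The buyer's type after observing the signals with weights `α`: the vector of conditional
expectations `θ_k = E[v_k | α_1 · v, …, α_n · v]`, as a random vector. -/
def buyerType {K n : ℕ} (F : Measure (Values K)) (α : Fin n → Fin K → ℝ) (v : Values K) :
    Fin K → ℝ :=
  fun k => condExp (MeasurableSpace.comap (signals α) inferInstance) F
    (fun w : Values K => w k) v

/-- A one-dimensional learning strategy is vertical if `Cov(v_k, α · v) ≥ 0` for every good. -/
def IsVertical {K : ℕ} (F : Measure (Values K)) (α : Fin K → ℝ) : Prop :=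
  ∀ k, 0 ≤ covariance (fun v : Values K => v k) (linearSignal α) F

/-- The learning strategy that acquires exactly one signal, the value of the grand bundle. -/
def learnGrandBundle (K : ℕ) : Fin 1 → Fin K → ℝ := fun _ _ => 1

/-! ### Selling mechanisms -/

/-- The set `Δ(2^K)` of lotteries over bundles. -/
abbrev Lottery (K : ℕ) : Type := stdSimplex ℝ (Finset (Fin K))

/-- The lottery that gives the bundle `B` for sure. -/
def sureBundle {K : ℕ} (B : Finset (Fin K)) : Lottery K :=
  ⟨Pi.single B 1, single_mem_stdSimplex ℝ B⟩

/-- A selling mechanism: a message space, an allocation rule and a payment rule, with a message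
that lets the buyer walk away. -/
structure Mechanism (K : ℕ) where
  /-- the message space -/
  M : Type
  /-- the allocation rule -/
  x : M → Lottery K
  /-- the payment rule -/
  p : M → ℝ
  exists_outside : ∃ m, x m = sureBundle ∅ ∧ p m = 0

/-- The probability that good `k` is allocated in a lottery. -/
def allocProb {K : ℕ} (w : Lottery K) (k : Fin K) : ℝ :=
  ∑ B : Finset (Fin K), if k ∈ B then w.1 B else 0

/-- The expected payoff `∑ k, θ_k x_k(m) - p(m)` of a buyer of type `θ` who sends message `m`. -/
def Mechanism.utility {K : ℕ} (S : Mechanism K) (θ : Fin K → ℝ) (m : S.M) : ℝ :=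
  ∑ k, θ k * allocProb (S.x m) k - S.p m

/-- The mechanism that offers only the grand bundle, at price `π` (and walking away). -/
def pureBundling (K : ℕ) (π : ℝ) : Mechanism K where
  M := Bool
  x := fun b => if b then sureBundle Finset.univ else sureBundle ∅
  p := fun b => if b then π else 0
  exists_outside := ⟨false, by simp⟩

/-! ### Equilibrium -/

/-- The buyer's ex ante payoff `E[sup_m (∑ k, θ_k x_k(m) - p(m))]` from the learning strategy `α`
against the mechanism `S`. The supremum is nonnegative because the buyer can walk away, so it
equals the supremum of the positive parts, and the expectation makes sense in `[0, ∞]`. -/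
def buyerPayoff {K n : ℕ} (F : Measure (Values K)) (α : Fin n → Fin K → ℝ) (S : Mechanism K) :
    ENNReal :=
  ∫⁻ v, ⨆ m : S.M, ENNReal.ofReal (S.utility (buyerType F α v) m) ∂F

/-- `r` is an optimal reporting rule: almost surely, the message sent after the observed signal
realization maximizes the buyer's expected payoff. The payment has a well-defined expectation. -/
def IsOptimalReport {K n : ℕ} (F : Measure (Values K)) (α : Fin n → Fin K → ℝ) (S : Mechanism K)
    (r : (Fin n → ℝ) → S.M) : Prop :=
  Integrable (fun v => S.p (r (signals α v))) F ∧
  ∀ᵐ v ∂F, ∀ m : S.M,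
    S.utility (buyerType F α v) m ≤ S.utility (buyerType F α v) (r (signals α v))

/-- The expected profits that the mechanism `S` can yield against `α`, over all ways in which the
buyer can break his indifferences. -/
def profits {K n : ℕ} (F : Measure (Values K)) (α : Fin n → Fin K → ℝ) (S : Mechanism K) :
    Set ℝ :=
  {R | ∃ r : (Fin n → ℝ) → S.M, IsOptimalReport F α S r ∧ R = ∫ v, S.p (r (signals α v)) ∂F}

/-- The mechanism `S` maximizes expected profit against the learning strategy `α`, where the buyer
breaks indifferences in favor of the seller (so the profit of `S` is the greatest element of
`profits F α S`). -/
def IsSellerOptimal {K n : ℕ} (F : Measure (Values K)) (α : Fin n → Fin K → ℝ)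
    (S : Mechanism K) : Prop :=
  ∃ R : ℝ, IsGreatest (profits F α S) R ∧
    ∀ S' : Mechanism K, ∀ R' ∈ profits F α S', R' ≤ R

/-- Pure-strategy Nash equilibrium of the game in which the buyer may acquire, for free, up to `N`
linear signals; `N = 1` is the game with one-dimensional learning. -/
def IsEquilibrium {K n : ℕ} (F : Measure (Values K)) (N : ℕ) (α : Fin n → Fin K → ℝ)
    (S : Mechanism K) : Prop :=
  n ≤ N ∧
  (∀ n' ≤ N, ∀ α' : Fin n' → Fin K → ℝ, buyerPayoff F α' S ≤ buyerPayoff F α S) ∧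
  IsSellerOptimal F α S

end Bundling

end

noncomputable section

namespace Bundling

/-! ### Symmetries of elliptical laws -/

/-! Write T = 1·v. By `IsPrior.covariance_bundle`, the numerators and denominators in the hypothesis
on the means are the covariances Cov(v_k, T), so the hypothesis says that the vector of means is
proportional to the vector of these covariances. Under an elliptical law E[v_k | T] is affine in T
with slope Cov(v_k, T) / Var T; this comes from reflection symmetries of the law
(`map_reflection_eq`). The proportionality is exactly what makes the intercepts vanish, so a buyer
who knows T has type wT, where w_k = μ_k / ∑ μ_i are nonnegative weights with sum 1
(`IsPrior.buyerType_learnGrandBundle`).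

Seller: against such a buyer every mechanism screens the scalar T with allocation ∑ w_k x_k in [0,
1]. Its indirect utility is convex with slopes in [0, 1], so up to a grid error its payments are
bounded by those of a randomization over posted prices, and the best posted price bounds its profit
(`integral_payment_le`). That price exists because T is bounded and atomless.

Buyer: against the bundle at price π, signals are worth E[(E[T | signals] - π)⁺], which by Jensen is
at most E[(T - π)⁺], the value of knowing T. This holds for any number of signals, so π does not
depend on N. -/

/-- If the characteristic function of `G` is a function of the quadratic form of `S`, then `G` is
invariant under the transpose of the `S`-orthogonal reflection that negates `u`. -/
lemma map_reflection_eq {K : ℕ} {G : Measure (Values K)} [IsProbabilityMeasure G]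
    {S : Matrix (Fin K) (Fin K) ℝ} {ψ : ℝ → ℂ} (hS : S.PosDef)
    (hψ : ∀ t : Values K, charFun G t = ψ (dotProduct t.ofLp (S.mulVec t.ofLp)))
    {u : Fin K → ℝ} (hu : u ≠ 0) :
    G.map (fun x : Values K => x - (2 * dotProduct u x.ofLp / dotProduct u (S.mulVec u)) •
      (WithLp.toLp 2 (S.mulVec u) : Values K)) = G := by
  have hq : 0 < dotProduct u (S.mulVec u) := by simpa using hS.dotProduct_mulVec_pos hu
  set q := dotProduct u (S.mulVec u) with hqdef
  have hsymm : ∀ x y : Fin K → ℝ, dotProduct x (S.mulVec y) = dotProduct y (S.mulVec x) := by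
    intro x y
    have h1 : S.transpose = S := by
      rw [← Matrix.conjTranspose_eq_transpose_of_trivial]
      exact hS.isHermitian.eq
    rw [Matrix.dotProduct_mulVec, ← Matrix.mulVec_transpose, h1, dotProduct_comm]
  have hcont : Continuous (fun x : Values K => x - (2 * dotProduct u x.ofLp / q) •
      (WithLp.toLp 2 (S.mulVec u) : Values K)) := by
    simp only [dotProduct]
    fun_prop
  have : IsProbabilityMeasure (G.map (fun x : Values K => x - (2 * dotProduct u x.ofLp / q) •
      (WithLp.toLp 2 (S.mulVec u) : Values K))) :=
    Measure.isProbabilityMeasure_map hcont.aemeasurable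
  refine Measure.ext_of_charFun (funext fun t => ?_)
  -- The map is moved to the other side of the inner product. Its transpose is the `S`-orthogonal
  -- reflection, which preserves the quadratic form and hence the characteristic function.
  have key : charFun (G.map (fun x : Values K => x - (2 * dotProduct u x.ofLp / q) •
      (WithLp.toLp 2 (S.mulVec u) : Values K))) t =
      charFun G (t - (2 * dotProduct u (S.mulVec t.ofLp) / q) • (WithLp.toLp 2 u : Values K)) := by
    rw [charFun_apply, charFun_apply, integral_map hcont.aemeasurable (by fun_prop)]
    congr 1
    ext x
    congr 3
    simp only [EuclideanSpace.inner_eq_star_dotProduct, star_trivial, WithLp.ofLp_sub,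
      WithLp.ofLp_smul, dotProduct_sub, sub_dotProduct, dotProduct_smul, smul_dotProduct,
      smul_eq_mul]
    rw [hsymm t.ofLp u]
    ring
  rw [key, hψ, hψ]
  congr 1
  simp only [WithLp.ofLp_sub, WithLp.ofLp_smul, dotProduct_sub, sub_dotProduct, dotProduct_smul,
    smul_dotProduct, smul_eq_mul, Matrix.mulVec_sub, Matrix.mulVec_smul]
  rw [hsymm t.ofLp u, ← hqdef]
  field_simp
  ring

/-- Under an elliptical law, two linear forms that are orthogonal for the scale matrix satisfy
`E[X g(Y)] = 0` for every measurable `g`, where `X` and `Y` are the centered forms. -/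
lemma integral_mul_comp_eq_zero {K : ℕ} {G : Measure (Values K)} [IsProbabilityMeasure G]
    {S : Matrix (Fin K) (Fin K) ℝ} {ψ : ℝ → ℂ} (hS : S.PosDef)
    (hψ : ∀ t : Values K, charFun G t = ψ (dotProduct t.ofLp (S.mulVec t.ofLp)))
    {u w : Fin K → ℝ} (huw : dotProduct w (S.mulVec u) = 0) {g : ℝ → ℝ} (hg : Measurable g) :
    ∫ x : Values K, dotProduct u x.ofLp * g (dotProduct w x.ofLp) ∂G = 0 := by
  rcases eq_or_ne u 0 with rfl | hu
  · simp
  have hq : 0 < dotProduct u (S.mulVec u) := by simpa using hS.dotProduct_mulVec_pos hu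
  have hcont : Continuous (fun x : Values K =>
      x - (2 * dotProduct u x.ofLp / dotProduct u (S.mulVec u)) •
      (WithLp.toLp 2 (S.mulVec u) : Values K)) := by
    simp only [dotProduct]
    fun_prop
  have hmeas : Measurable (fun x : Values K => dotProduct u x.ofLp * g (dotProduct w x.ofLp)) := by
    simp only [dotProduct]
    refine Measurable.mul (by fun_prop) (hg.comp (by fun_prop))
  have h := integral_map (μ := G) hcont.aemeasurable hmeas.aestronglyMeasurable
  rw [map_reflection_eq hS hψ hu] at h
  -- The reflection negates u·x and, since w·Su = 0, fixes w·x. The integral therefore equals its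
  -- own negative, and no integrability is needed.
  have h2 : ∀ x : Values K, dotProduct u (x - (2 * dotProduct u x.ofLp /
      dotProduct u (S.mulVec u)) • (WithLp.toLp 2 (S.mulVec u) : Values K)).ofLp *
      g (dotProduct w (x - (2 * dotProduct u x.ofLp /
      dotProduct u (S.mulVec u)) • (WithLp.toLp 2 (S.mulVec u) : Values K)).ofLp) =
      -(dotProduct u x.ofLp * g (dotProduct w x.ofLp)) := by
    intro x
    simp only [WithLp.ofLp_sub, WithLp.ofLp_smul, dotProduct_sub, dotProduct_smul, smul_eq_mul,
      huw, mul_zero, sub_zero]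
    field_simp
    ring
  simp only [h2, integral_neg] at h
  linarith

/-- The regression of `v k` on the grand bundle value is affine under an elliptical law. -/
lemma IsElliptical.exists_regression {K : ℕ} {F : Measure (Values K)} [IsProbabilityMeasure F]
    (hF : IsElliptical F) (k : Fin K) :
    ∃ a κ : ℝ, ∀ g : ℝ → ℝ, Measurable g →
      ∫ v : Values K, (v k - a * linearSignal (fun _ => 1) v - κ) *
        g (linearSignal (fun _ => 1) v) ∂F = 0 := by
  obtain ⟨μ, S, ψ, hS, hψ⟩ := hF
  have hone : (1 : Fin K → ℝ) ≠ 0 := fun h => by simpa using congrFun h k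
  have hq : 0 < dotProduct (1 : Fin K → ℝ) (S.mulVec 1) := by
    simpa using hS.dotProduct_mulVec_pos hone
  set s := dotProduct (1 : Fin K → ℝ) (S.mulVec 1) with hs
  -- This slope makes e_k - a·1 orthogonal to 1 for `S`; the location vector then fixes the
  -- intercept.
  set a := dotProduct (1 : Fin K → ℝ) (S.mulVec (Pi.single k 1)) / s with ha
  have hmap : AEMeasurable (fun v : Values K => v - μ) F := by fun_prop
  have : IsProbabilityMeasure (F.map (fun v => v - μ)) := Measure.isProbabilityMeasure_map hmap
  refine ⟨a, μ k - a * linearSignal (fun _ => 1) μ, fun g hg => ?_⟩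
  have huw : dotProduct (1 : Fin K → ℝ) (S.mulVec (Pi.single k 1 - a • 1)) = 0 := by
    rw [Matrix.mulVec_sub, Matrix.mulVec_smul, dotProduct_sub, dotProduct_smul, smul_eq_mul,
      ← hs, ha]
    field_simp
    ring
  have hg' : Measurable (fun t => g (t + linearSignal (fun _ => 1) μ)) := hg.comp (by fun_prop)
  have h := integral_mul_comp_eq_zero hS hψ huw hg'
  rw [integral_map hmap] at h
  · rw [← h]
    congr 1
    ext v
    simp only [linearSignal, dotProduct_sub, sub_dotProduct, smul_dotProduct, single_dotProduct,
      one_dotProduct, WithLp.ofLp_sub, smul_eq_mul, one_mul,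
      sub_add_cancel]
  · refine Measurable.aestronglyMeasurable ?_
    simp only [dotProduct]
    refine Measurable.mul (by fun_prop) (hg'.comp (by fun_prop))

/-! ### Regularity of laws with a density on a compact set -/

lemma HasContinuousCompactDensity.absolutelyContinuous {K : ℕ} {F : Measure (Values K)}
    (hF : HasContinuousCompactDensity F) : F ≪ volume := by
  obtain ⟨V, f, -, -, -, -, -, rfl⟩ := hF
  exact withDensity_absolutelyContinuous _ _

lemma HasContinuousCompactDensity.exists_ae_mem {K : ℕ} {F : Measure (Values K)}
    (hF : HasContinuousCompactDensity F) :
    ∃ C : ℝ, ∀ᵐ v ∂F, ∀ k, 0 ≤ v k ∧ v k ≤ C := by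
  obtain ⟨V, f, hV, hnn, hf, hfc, hf0, rfl⟩ := hF
  obtain ⟨C, hC⟩ := hV.isBounded.exists_norm_le
  have hVm : MeasurableSet Vᶜ := hV.isClosed.measurableSet.compl
  have h0 : (volume.withDensity (fun v => ENNReal.ofReal (f v))) Vᶜ = 0 := by
    rw [withDensity_apply _ hVm, setLIntegral_congr_fun (g := fun _ => 0) hVm]
    · simp
    · intro v hv
      simp [hf0 v hv]
  refine ⟨C, ?_⟩
  filter_upwards [mem_ae_iff.2 h0] with v hv k
  refine ⟨hnn v hv k, ?_⟩
  calc v k ≤ ‖v k‖ := Real.le_norm_self _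
    _ ≤ ‖v‖ := PiLp.norm_apply_le v k
    _ ≤ C := hC v hv

/-- A level set of a nonzero linear form is a proper affine subspace. This makes the signals
atomless under any law with a density. -/
lemma volume_linearSignal_eq {K : ℕ} {α : Fin K → ℝ} (hα : α ≠ 0) (c : ℝ) :
    volume {v : Values K | linearSignal α v = c} = 0 := by
  obtain ⟨k, hk⟩ := Function.ne_iff.1 hα
  let L : Values K →ₗ[ℝ] ℝ := ∑ k, α k • (EuclideanSpace.proj k : Values K →L[ℝ] ℝ).toLinearMap
  have hL : ∀ v, L v = linearSignal α v := fun v => by simp [L, linearSignal]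
  let s : AffineSubspace ℝ (Values K) :=
    AffineSubspace.comap L.toAffineMap (AffineSubspace.mk' c ⊥)
  have hs : (s : Set (Values K)) = {v | linearSignal α v = c} := by
    ext v
    simp [s, hL, AffineSubspace.mem_mk', sub_eq_zero]
  rw [← hs]
  refine Measure.addHaar_affineSubspace _ _ fun htop => ?_
  have h : ∀ v, linearSignal α v = c := fun v => by
    have : v ∈ (s : Set (Values K)) := by rw [htop]; trivial
    rwa [hs] at this
  have h0 : c = 0 := by rw [← h 0]; simp [linearSignal]
  have h1 := h (EuclideanSpace.single k 1)
  simp [linearSignal, h0] at h1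
  exact hk (by simpa using h1)

@[fun_prop]
lemma continuous_linearSignal {K : ℕ} (α : Fin K → ℝ) :
    Continuous (linearSignal α : Values K → ℝ) := by
  unfold linearSignal
  fun_prop

@[fun_prop]
lemma measurable_linearSignal {K : ℕ} (α : Fin K → ℝ) :
    Measurable (linearSignal α : Values K → ℝ) := (continuous_linearSignal α).measurable

lemma measurable_signals {K n : ℕ} (α : Fin n → Fin K → ℝ) :
    Measurable (signals α : Values K → Fin n → ℝ) :=
  measurable_pi_lambda _ fun j => measurable_linearSignal (α j)

lemma HasContinuousCompactDensity.memLp_apply {K : ℕ} {F : Measure (Values K)}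
    [IsProbabilityMeasure F] (hF : HasContinuousCompactDensity F) (k : Fin K) :
    MemLp (fun v : Values K => v k) 2 F := by
  obtain ⟨C, hC⟩ := hF.exists_ae_mem
  refine MemLp.of_bound (by fun_prop) C ?_
  filter_upwards [hC] with v hv
  rw [Real.norm_of_nonneg (hv k).1]
  exact (hv k).2

lemma HasContinuousCompactDensity.memLp_linearSignal {K : ℕ} {F : Measure (Values K)}
    [IsProbabilityMeasure F] (hF : HasContinuousCompactDensity F) (α : Fin K → ℝ) :
    MemLp (linearSignal α : Values K → ℝ) 2 F :=
  memLp_finsetSum _ fun k _ => (hF.memLp_apply k).const_mul (α k)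

lemma HasContinuousCompactDensity.measure_linearSignal_eq {K : ℕ} {F : Measure (Values K)}
    (hF : HasContinuousCompactDensity F) {α : Fin K → ℝ} (hα : α ≠ 0) (c : ℝ) :
    ∀ᵐ v ∂F, linearSignal α v ≠ c :=
  hF.absolutelyContinuous.ae_le (measure_eq_zero_iff_ae_notMem.1 (volume_linearSignal_eq hα c))

lemma HasContinuousCompactDensity.variance_linearSignal_pos {K : ℕ} {F : Measure (Values K)}
    [IsProbabilityMeasure F] (hF : HasContinuousCompactDensity F) {α : Fin K → ℝ} (hα : α ≠ 0) :
    0 < variance (linearSignal α) F := by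
  have hL := hF.memLp_linearSignal α
  refine lt_of_le_of_ne (variance_nonneg _ _) fun h0 => ?_
  have hi : Integrable (fun v => (linearSignal α v - ∫ v, linearSignal α v ∂F) ^ 2) F :=
    (hL.sub (memLp_const _)).integrable_sq
  rw [variance_eq_integral hL.aemeasurable, eq_comm, integral_eq_zero_iff_of_nonneg_ae
    (ae_of_all _ fun _ => sq_nonneg _) hi] at h0
  obtain ⟨v, h1, h2⟩ := (h0.and (hF.measure_linearSignal_eq hα (∫ v, linearSignal α v ∂F))).exists
  exact h2 (sub_eq_zero.1 (by simpa using h1))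

lemma linearSignal_single {K : ℕ} (k : Fin K) :
    (linearSignal (Pi.single k 1) : Values K → ℝ) = fun v => v k := by
  ext v
  simp [linearSignal, Pi.single_apply]

lemma HasContinuousCompactDensity.stdDev_pos {K : ℕ} {F : Measure (Values K)}
    [IsProbabilityMeasure F] (hF : HasContinuousCompactDensity F) (k : Fin K) :
    0 < stdDev F k := by
  have h := hF.variance_linearSignal_pos (α := Pi.single k 1) (by simp)
  rw [linearSignal_single] at h
  exact Real.sqrt_pos.2 h

lemma HasContinuousCompactDensity.mean_pos {K : ℕ} {F : Measure (Values K)}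
    [IsProbabilityMeasure F] (hF : HasContinuousCompactDensity F) (k : Fin K) :
    0 < mean F k := by
  obtain ⟨C, hC⟩ := hF.exists_ae_mem
  have hnn : 0 ≤ᵐ[F] fun v : Values K => v k := hC.mono fun v hv => (hv k).1
  refine lt_of_le_of_ne (integral_nonneg_of_ae hnn) fun h0 => ?_
  rw [mean, eq_comm, integral_eq_zero_iff_of_nonneg_ae hnn
    ((hF.memLp_apply k).integrable (by norm_num))] at h0
  have h1 := hF.measure_linearSignal_eq (α := Pi.single k 1) (by simp) 0
  rw [linearSignal_single] at h1
  obtain ⟨v, h1, h2⟩ := (h0.and h1).exists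
  exact h2 h1

lemma HasContinuousCompactDensity.integral_bundle {K : ℕ} {F : Measure (Values K)}
    [IsProbabilityMeasure F] (hF : HasContinuousCompactDensity F) :
    ∫ v, linearSignal (fun _ => 1) v ∂F = ∑ k, mean F k := by
  simp only [linearSignal, one_mul, mean]
  exact integral_finsetSum _ fun k _ => (hF.memLp_apply k).integrable (by norm_num)

/-- Identifies the expressions in the hypothesis on the means as covariances with the grand bundle
value. -/
lemma IsPrior.covariance_bundle {K : ℕ} {F : Measure (Values K)} {ρ : ℝ} (hF : IsPrior F ρ)
    (k : Fin K) :
    covariance (fun v : Values K => v k) (linearSignal (fun _ => 1)) F =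
      stdDev F k ^ 2 + ρ * stdDev F k * ∑ j ∈ Finset.univ.erase k, stdDev F j := by
  have := hF.isProbabilityMeasure
  have hm := hF.density.memLp_apply
  have h1 : (linearSignal (fun _ => 1) : Values K → ℝ) = fun v => ∑ j, v j := by
    ext v; simp [linearSignal]
  rw [h1, covariance_fun_sum_right hm (hm k), ← Finset.add_sum_erase _ _ (Finset.mem_univ k),
    covariance_self (hm k).aemeasurable, stdDev, Real.sq_sqrt (variance_nonneg _ _),
    Finset.mul_sum]
  congr 1
  refine Finset.sum_congr rfl fun j hj => ?_
  have h := hF.corr_eq k j (Finset.ne_of_mem_erase hj).symm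
  have hk := (hF.density.stdDev_pos k).ne'
  have hj := (hF.density.stdDev_pos j).ne'
  rw [corr, div_eq_iff (mul_ne_zero hk hj)] at h
  rw [h, mul_assoc]
  rfl

lemma IsPrior.sum_covariance_bundle {K : ℕ} {F : Measure (Values K)} {ρ : ℝ}
    (hF : IsPrior F ρ) :
    ∑ k, covariance (fun v : Values K => v k) (linearSignal (fun _ => 1)) F =
      variance (linearSignal (fun _ => 1)) F := by
  have := hF.isProbabilityMeasure
  have hT := hF.density.memLp_linearSignal (fun _ => 1)
  rw [← covariance_fun_sum_left hF.density.memLp_apply hT, ← covariance_self hT.aemeasurable]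
  congr 1
  ext v
  simp [linearSignal]

/-- The alignment of the means with the covariances, free of divisions. -/
lemma IsPrior.sum_mean_mul_covariance {K : ℕ} {F : Measure (Values K)} {ρ : ℝ}
    (hF : IsPrior F ρ)
    (hμ : ∀ i j : Fin K, i ≠ j →
      mean F i =
        (stdDev F i ^ 2 + ρ * stdDev F i * ∑ k ∈ Finset.univ.erase i, stdDev F k) /
          (stdDev F j ^ 2 + ρ * stdDev F j * ∑ k ∈ Finset.univ.erase j, stdDev F k) *
        mean F j) (j : Fin K) :
    (∑ i, mean F i) * covariance (fun v : Values K => v j) (linearSignal (fun _ => 1)) F =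
      variance (linearSignal (fun _ => 1)) F * mean F j := by
  have := hF.isProbabilityMeasure
  rw [← hF.sum_covariance_bundle, Finset.sum_mul, Finset.sum_mul]
  refine Finset.sum_congr rfl fun i _ => ?_
  rcases eq_or_ne i j with rfl | hij
  · ring
  have h := hμ i j hij
  rw [← hF.covariance_bundle, ← hF.covariance_bundle] at h
  have hpos := hF.density.mean_pos i
  -- A zero denominator would make the quotient, and with it the mean of good i, equal to 0, against
  -- `mean_pos`.
  have hne : covariance (fun v : Values K => v j) (linearSignal (fun _ => 1)) F ≠ 0 := by
    intro h0
    rw [h0] at h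
    simp [h] at hpos
  rw [h]
  field_simp

lemma IsPrior.isVertical_bundle {K : ℕ} {F : Measure (Values K)} {ρ : ℝ} (hF : IsPrior F ρ)
    (hμ : ∀ j : Fin K,
      (∑ i, mean F i) * covariance (fun v : Values K => v j) (linearSignal (fun _ => 1)) F =
        variance (linearSignal (fun _ => 1)) F * mean F j) :
    IsVertical F (fun _ => 1) := by
  have := hF.isProbabilityMeasure
  intro k
  have hsum : 0 < ∑ i, mean F i :=
    Finset.sum_pos (fun i _ => hF.density.mean_pos i) ⟨k, Finset.mem_univ k⟩
  refine nonneg_of_mul_nonneg_right (a := ∑ i, mean F i) ?_ hsum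
  rw [hμ k]
  exact mul_nonneg (variance_nonneg _ _) (hF.density.mean_pos k).le

/-- When the means are aligned with the covariances, the type of a buyer who knows the grand bundle
value is proportional to that value. -/
lemma IsPrior.buyerType_learnGrandBundle {K : ℕ} {F : Measure (Values K)} {ρ : ℝ}
    (hF : IsPrior F ρ)
    (hμ : ∀ j : Fin K,
      (∑ i, mean F i) * covariance (fun v : Values K => v j) (linearSignal (fun _ => 1)) F =
        variance (linearSignal (fun _ => 1)) F * mean F j) (k : Fin K) :
    (fun v => buyerType F (learnGrandBundle K) v k) =ᵐ[F]
      fun v => mean F k / (∑ i, mean F i) * linearSignal (fun _ => 1) v := by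
  have := hF.isProbabilityMeasure
  set T : Values K → ℝ := linearSignal (fun _ => 1) with hTdef
  have hT : MemLp T 2 F := hF.density.memLp_linearSignal _
  have hTi : Integrable T F := hT.integrable (by norm_num)
  have hk := hF.density.memLp_apply k
  have hki := hk.integrable (q := 2) (by norm_num)
  have hsum : 0 < ∑ i, mean F i :=
    Finset.sum_pos (fun i _ => hF.density.mean_pos i) ⟨k, Finset.mem_univ k⟩
  have hone : (fun _ : Fin K => (1 : ℝ)) ≠ 0 := fun h => by simpa using congrFun h k
  have hvar : 0 < variance T F := hF.density.variance_linearSignal_pos hone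
  obtain ⟨a, κ, hreg⟩ := hF.elliptical.exists_regression k
  rw [← hTdef] at hreg
  have hTa : Integrable (fun v => a * T v) F := hTi.const_mul a
  have hres : Integrable (fun v => v k - a * T v) F := hki.sub hTa
  -- Testing the regression against g = 1 here, and against g = id in `e2`, gives the two normal
  -- equations, whence a = Cov(v_k, T) / Var T.
  have e1 : mean F k - a * (∑ i, mean F i) - κ = 0 := by
    have h := hreg (fun _ => 1) measurable_const
    simp only [mul_one] at h
    rw [integral_sub hres (integrable_const _), integral_sub hki hTa, integral_const_mul,
      hF.density.integral_bundle] at h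
    simpa [mean] using h
  have hkT : Integrable (fun v => v k * T v) F := hk.integrable_mul hT
  have hTT : Integrable (fun v => T v * T v) F := hT.integrable_mul hT
  have e2 : ∫ v, v k * T v ∂F - a * ∫ v, T v * T v ∂F - κ * ∑ i, mean F i = 0 := by
    have h := hreg (fun t => t) measurable_id
    have hi : Integrable (fun v => v k * T v - a * (T v * T v)) F := hkT.sub (hTT.const_mul a)
    rw [← h, ← hF.density.integral_bundle, ← integral_const_mul, ← integral_const_mul,
      ← integral_sub hkT (hTT.const_mul a), ← integral_sub hi (hTi.const_mul κ)]
    congr 1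
    ext v
    ring
  have e3 : covariance (fun v : Values K => v k) T F =
      ∫ v, v k * T v ∂F - mean F k * ∑ i, mean F i := by
    rw [covariance_eq_sub hk hT, hF.density.integral_bundle]
    rfl
  have e4 : variance T F = ∫ v, T v * T v ∂F - (∑ i, mean F i) ^ 2 := by
    rw [variance_eq_sub hT, hF.density.integral_bundle]
    simp [pow_two]
  have e5 : covariance (fun v : Values K => v k) T F = a * variance T F := by
    rw [e3, e4]
    linear_combination e2 - (∑ i, mean F i) * e1
  -- Alignment of means and covariances enters here: it forces the intercept κ to vanish.
  have e6 : a * ∑ i, mean F i = mean F k := by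
    have h := hμ k
    rw [e5] at h
    exact mul_left_cancel₀ hvar.ne' (by linear_combination h)
  have hκ : κ = 0 := by linear_combination -e1 - e6
  have ha : mean F k / (∑ i, mean F i) = a := by rw [← e6]; field_simp
  rw [ha]
  have hm := (measurable_signals (learnGrandBundle K)).comap_le
  have hTm : Measurable[MeasurableSpace.comap (signals (learnGrandBundle K)) inferInstance] T :=
    (measurable_pi_apply (0 : Fin 1)).comp (comap_measurable (signals (learnGrandBundle K)))
  refine (ae_eq_condExp_of_forall_setIntegral_eq hm hki
    (fun s _ _ => hTa.integrableOn) ?_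
    (hTm.const_mul a).stronglyMeasurable.aestronglyMeasurable).symm
  rintro s ⟨A, hA, rfl⟩ -
  have hB : MeasurableSet {t : ℝ | (fun _ : Fin 1 => t) ∈ A} :=
    hA.preimage (measurable_pi_lambda _ fun _ => measurable_id)
  -- Events of the signal's σ-algebra have the form {T ∈ B}, so testing against indicators of B
  -- characterizes the conditional expectation.
  have h := hreg ({t : ℝ | (fun _ : Fin 1 => t) ∈ A}.indicator fun _ => 1)
    (measurable_const.indicator hB)
  have hs : MeasurableSet (signals (learnGrandBundle K) ⁻¹' A : Set (Values K)) :=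
    measurable_signals _ hA
  have h' : ∫ v in signals (learnGrandBundle K) ⁻¹' A, (v k - a * T v) ∂F = 0 := by
    rw [← integral_indicator hs, ← h]
    congr 1
    ext v
    by_cases hv : T v ∈ {t : ℝ | (fun _ : Fin 1 => t) ∈ A}
    · rw [Set.indicator_of_mem (show v ∈ signals (learnGrandBundle K) ⁻¹' A from hv),
        Set.indicator_of_mem hv, hκ]
      ring
    · rw [Set.indicator_of_notMem (show v ∉ signals (learnGrandBundle K) ⁻¹' A from hv),
        Set.indicator_of_notMem hv, mul_zero]
  rw [integral_sub hki.integrableOn hTa.integrableOn] at h'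
  linarith

/-! ### One-dimensional screening -/

/-- The indirect utility of a type `t` with the affine menu `m ↦ t * q m - p m`. -/
def indirectUtility {ι : Type*} (q p : ι → ℝ) (t : ℝ) : ℝ := ⨆ m, (t * q m - p m)

section Screening

variable {ι : Type*} {q p : ι → ℝ}

/-- One type with an optimal message suffices: slopes in [0, 1] let the supremum grow by at most |s
- t|. Without boundedness the real-valued `⨆` would default to 0. -/
lemma bddAbove_menu (hq : ∀ m, q m ∈ Set.Icc (0 : ℝ) 1) {t : ℝ} {r : ι}
    (hr : ∀ m, t * q m - p m ≤ t * q r - p r) (s : ℝ) :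
    BddAbove (Set.range fun m => s * q m - p m) := by
  refine ⟨t * q r - p r + |s - t|, ?_⟩
  rintro _ ⟨m, rfl⟩
  have h1 := hr m
  have h2 : (s - t) * q m ≤ |s - t| :=
    calc (s - t) * q m ≤ |s - t| * q m := mul_le_mul_of_nonneg_right (le_abs_self _) (hq m).1
      _ ≤ |s - t| := mul_le_of_le_one_right (abs_nonneg _) (hq m).2
  simp only
  linarith

lemma le_indirectUtility (hb : ∀ s, BddAbove (Set.range fun m => s * q m - p m)) (s : ℝ) (m : ι) :
    s * q m - p m ≤ indirectUtility q p s :=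
  le_ciSup (hb s) m

variable [Nonempty ι]

lemma indirectUtility_mono (hq : ∀ m, q m ∈ Set.Icc (0 : ℝ) 1)
    (hb : ∀ s, BddAbove (Set.range fun m => s * q m - p m)) : Monotone (indirectUtility q p) :=
  fun s t hst => ciSup_le fun m => (le_indirectUtility hb t m).trans' <| by
    have := mul_le_mul_of_nonneg_right hst (hq m).1
    linarith

lemma indirectUtility_add_le (hq : ∀ m, q m ∈ Set.Icc (0 : ℝ) 1)
    (hb : ∀ s, BddAbove (Set.range fun m => s * q m - p m)) (s : ℝ) {h : ℝ} (hh : 0 ≤ h) :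
    indirectUtility q p (s + h) ≤ indirectUtility q p s + h :=
  ciSup_le fun m => by
    have h1 := le_indirectUtility hb s m
    have h2 := mul_le_of_le_one_right hh (hq m).2
    linarith

lemma two_mul_indirectUtility_le (hb : ∀ s, BddAbove (Set.range fun m => s * q m - p m))
    (s h : ℝ) :
    2 * indirectUtility q p s ≤ indirectUtility q p (s - h) + indirectUtility q p (s + h) := by
  suffices indirectUtility q p s ≤
      (indirectUtility q p (s - h) + indirectUtility q p (s + h)) / 2 by linarith
  refine ciSup_le fun m => ?_
  have h1 := le_indirectUtility hb (s - h) m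
  have h2 := le_indirectUtility hb (s + h) m
  linarith

/-- By convexity, second differences can serve as weights on posted prices: divided by h, the one
indexed by j is the weight of price jh. -/
lemma indirectUtility_secondDifference_nonneg
    (hb : ∀ s, BddAbove (Set.range fun m => s * q m - p m)) (h : ℝ) (j : ℕ) :
    0 ≤ indirectUtility q p ((j + 2 : ℕ) * h) - 2 * indirectUtility q p ((j + 1 : ℕ) * h) +
      indirectUtility q p (j * h) := by
  have h1 := two_mul_indirectUtility_le hb ((j + 1 : ℕ) * h) h
  have e1 : ((j + 1 : ℕ) : ℝ) * h - h = j * h := by push_cast; ring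
  have e2 : ((j + 1 : ℕ) : ℝ) * h + h = (j + 2 : ℕ) * h := by push_cast; ring
  rw [e1, e2] at h1
  linarith

/-- The allocation of a type `t` is a lower bound for the slope of the indirect utility at the
right of `t`. -/
lemma indirectUtility_add_mul_le (hb : ∀ s, BddAbove (Set.range fun m => s * q m - p m))
    {t : ℝ} {r : ι} (hr : ∀ m, t * q m - p m ≤ t * q r - p r) {s h : ℝ} (hts : t ≤ s)
    (hh : 0 ≤ h) :
    indirectUtility q p s + h * q r ≤ indirectUtility q p (s + h) := by
  suffices indirectUtility q p s ≤ indirectUtility q p (s + h) - h * q r by linarith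
  refine ciSup_le fun m => ?_
  rcases le_total (q r) (q m) with hm | hm
  · have h1 := le_indirectUtility hb (s + h) m
    have h2 := mul_le_mul_of_nonneg_left hm hh
    linarith
  · have h1 := le_indirectUtility hb (s + h) r
    have h2 := mul_le_mul_of_nonneg_left hm (sub_nonneg.2 hts)
    have h3 := hr m
    linarith

/-- Summation by parts, the discrete form of ∫ s dU'(s) = tU'(t) - (U(t) - U(0)), which is the
envelope formula for payments. -/
lemma sum_secondDifference_mul (u : ℕ → ℝ) (i : ℕ) :
    ∑ j ∈ Finset.range (i + 1), (u (j + 2) - 2 * u (j + 1) + u j) * j =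
      i * (u (i + 2) - u (i + 1)) - (u (i + 1) - u 1) := by
  induction i with
  | zero => simp
  | succ i ih =>
    rw [Finset.sum_range_succ, ih]
    push_cast
    ring

lemma sum_secondDifference (u : ℕ → ℝ) (n : ℕ) :
    ∑ j ∈ Finset.range n, (u (j + 2) - 2 * u (j + 1) + u j) =
      (u (n + 1) - u n) - (u 1 - u 0) := by
  induction n with
  | zero => simp
  | succ n ih =>
    rw [Finset.sum_range_succ, ih]
    ring

/-- The payment of a type `t` is at most the expected payment under a randomization over posted
prices on a grid of mesh `h`, up to `2 * h`. -/
lemma payment_le_sum_postedPrices (hq : ∀ m, q m ∈ Set.Icc (0 : ℝ) 1)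
    (hb : ∀ s, BddAbove (Set.range fun m => s * q m - p m)) (h0 : 0 ≤ indirectUtility q p 0)
    {t h : ℝ} (ht : 0 ≤ t) (hh : 0 < h) {n : ℕ} (hn : t < n * h) {r : ι}
    (hr : ∀ m, t * q m - p m ≤ t * q r - p r) :
    p r ≤ ∑ j ∈ Finset.range n, (indirectUtility q p ((j + 2 : ℕ) * h) -
        2 * indirectUtility q p ((j + 1 : ℕ) * h) + indirectUtility q p (j * h)) * j *
        (if j * h ≤ t then 1 else 0) + 2 * h := by
  set u : ℕ → ℝ := fun j => indirectUtility q p (j * h) with hu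
  have hmono := indirectUtility_mono hq hb
  have hW : ∀ j, 0 ≤ u (j + 2) - 2 * u (j + 1) + u j :=
    indirectUtility_secondDifference_nonneg hb h
  set i := ⌊t / h⌋₊ with hi
  have hit : i * h ≤ t := (le_div_iff₀ hh).1 (Nat.floor_le (div_nonneg ht hh.le))
  have hti : t < (i + 1 : ℕ) * h := by
    push_cast
    exact (div_lt_iff₀ hh).1 (Nat.lt_floor_add_one _)
  have hin : i + 1 ≤ n := by
    have : (i : ℝ) * h < n * h := hit.trans_lt hn
    have := lt_of_mul_lt_mul_right this hh.le
    exact_mod_cast this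
  have hsum : ∑ j ∈ Finset.range (i + 1), (u (j + 2) - 2 * u (j + 1) + u j) * j ≤
      ∑ j ∈ Finset.range n, (u (j + 2) - 2 * u (j + 1) + u j) * j *
        (if j * h ≤ t then 1 else 0) := by
    refine le_trans (Finset.sum_le_sum fun j hj => ?_)
      (Finset.sum_le_sum_of_subset_of_nonneg (Finset.range_mono hin) fun j _ _ => ?_)
    · have hji : (j : ℝ) ≤ i := by exact_mod_cast Nat.lt_succ_iff.1 (Finset.mem_range.1 hj)
      rw [if_pos ((mul_le_mul_of_nonneg_right hji hh.le).trans hit), mul_one]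
    · exact mul_nonneg (mul_nonneg (hW j) (Nat.cast_nonneg j)) (by split_ifs <;> norm_num)
  rw [sum_secondDifference_mul] at hsum
  have e2 : ((i + 1 : ℕ) : ℝ) * h + h = (i + 2 : ℕ) * h := by push_cast; ring
  have e1 : (i : ℝ) * h + h = (i + 1 : ℕ) * h := by push_cast; ring
  -- The slope is taken on the cell after the one containing t, since `q r` bounds slopes only to
  -- the right of t.
  have a1 : u (i + 1) + h * q r ≤ u (i + 2) := by
    have := indirectUtility_add_mul_le hb hr hti.le hh.le
    rwa [e2] at this
  have a2 : u (i + 2) ≤ u (i + 1) + h := by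
    have := indirectUtility_add_le hq hb ((i + 1 : ℕ) * h) hh.le
    rwa [e2] at this
  have a3 : u (i + 1) ≤ u i + h := by
    have := indirectUtility_add_le hq hb (i * h) hh.le
    rwa [e1] at this
  have a4 : u i ≤ t * q r - p r := (hmono hit).trans (ciSup_le hr)
  have a5 : 0 ≤ u 1 := h0.trans (hmono (by positivity))
  -- One error h comes from rounding t up to (i + 1)h, the other from replacing `u i` by `u (i + 1)`
  -- in `a3`.
  have a6 : t * q r ≤ (i + 1 : ℕ) * h * q r := mul_le_mul_of_nonneg_right hti.le (hq r).1
  have a7 : ((i + 1 : ℕ) : ℝ) * (h * q r) ≤ (i + 1 : ℕ) * (u (i + 2) - u (i + 1)) :=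
    mul_le_mul_of_nonneg_left (by linarith) (by positivity)
  push_cast at a6 a7
  linarith

/-- Screening a one-dimensional type is no better than the best posted price. -/
theorem integral_payment_le {Ω : Type*} {mΩ : MeasurableSpace Ω} {P : Measure Ω}
    [IsProbabilityMeasure P] {T : Ω → ℝ} (hT : Measurable T) {C : ℝ}
    (hTC : ∀ᵐ ω ∂P, 0 ≤ T ω ∧ T ω ≤ C) (hq : ∀ m, q m ∈ Set.Icc (0 : ℝ) 1)
    (h0 : ∃ m, p m = 0) {r : Ω → ι} (hr : Integrable (fun ω => p (r ω)) P)
    (hIC : ∀ᵐ ω ∂P, ∀ m, T ω * q m - p m ≤ T ω * q (r ω) - p (r ω)) {R : ℝ}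
    (hR : ∀ s, 0 ≤ s → s * P.real {ω | s ≤ T ω} ≤ R) :
    ∫ ω, p (r ω) ∂P ≤ R := by
  obtain ⟨ω₀, hω₀⟩ := hIC.exists
  have hb := bddAbove_menu hq hω₀
  obtain ⟨m₀, hm₀⟩ := h0
  have hU0 : 0 ≤ indirectUtility q p 0 := by
    have := le_indirectUtility hb 0 m₀
    rw [hm₀] at this
    linarith
  have hR0 : 0 ≤ R := by simpa using hR 0 le_rfl
  refine le_of_forall_pos_le_add fun ε hε => ?_
  -- The grid error 2h is then exactly ε.
  set h := ε / 2 with hhdef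
  have hh : 0 < h := by positivity
  obtain ⟨n, hn⟩ := exists_nat_gt (C / h)
  rw [div_lt_iff₀ hh] at hn
  set u : ℕ → ℝ := fun j => indirectUtility q p (j * h) with hu
  have hW : ∀ j, 0 ≤ u (j + 2) - 2 * u (j + 1) + u j :=
    indirectUtility_secondDifference_nonneg hb h
  have hset : ∀ j : ℕ, MeasurableSet {ω | j * h ≤ T ω} := fun j =>
    measurableSet_le measurable_const hT
  have hind : ∀ j : ℕ, (fun ω => if j * h ≤ T ω then (1 : ℝ) else 0) =
      {ω | j * h ≤ T ω}.indicator fun _ => 1 := fun j => by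
    ext ω
    simp [Set.indicator_apply]
  have hint : ∀ j : ℕ, Integrable (fun ω => if j * h ≤ T ω then (1 : ℝ) else 0) P := fun j => by
    rw [hind]
    exact (integrable_const _).indicator (hset j)
  have hsumint : Integrable (fun ω => ∑ j ∈ Finset.range n,
      (u (j + 2) - 2 * u (j + 1) + u j) * j * (if j * h ≤ T ω then 1 else 0)) P :=
    integrable_finsetSum _ fun j _ => (hint j).const_mul _
  calc ∫ ω, p (r ω) ∂P
      ≤ ∫ ω, (∑ j ∈ Finset.range n, (u (j + 2) - 2 * u (j + 1) + u j) * j *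
          (if j * h ≤ T ω then 1 else 0) + 2 * h) ∂P := by
        refine integral_mono_ae hr (hsumint.add (integrable_const _)) ?_
        filter_upwards [hIC, hTC] with ω h1 h2
        exact payment_le_sum_postedPrices hq hb hU0 h2.1 hh (h2.2.trans_lt hn) h1
    _ = ∑ j ∈ Finset.range n, (u (j + 2) - 2 * u (j + 1) + u j) * j *
          P.real {ω | j * h ≤ T ω} + 2 * h := by
        rw [integral_add hsumint (integrable_const _),
          integral_finsetSum _ fun j _ => (hint j).const_mul _]
        congr 1
        · refine Finset.sum_congr rfl fun j _ => ?_
          rw [integral_const_mul, hind, integral_indicator_const _ (hset j)]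
          simp
        · simp
    _ ≤ ∑ j ∈ Finset.range n, (u (j + 2) - 2 * u (j + 1) + u j) * (R / h) + 2 * h := by
        refine add_le_add_left (Finset.sum_le_sum fun j _ => ?_) _
        rw [mul_assoc]
        refine mul_le_mul_of_nonneg_left ?_ (hW j)
        rw [le_div_iff₀ hh]
        have := hR (j * h) (by positivity)
        linarith
    _ = ((u (n + 1) - u n) - (u 1 - u 0)) * (R / h) + 2 * h := by
        rw [← Finset.sum_mul, sum_secondDifference]
    -- The weights sum to a difference of two increments of u, at most h because slopes lie in [0,
    -- 1]. Divided by h they thus have total mass at most 1.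
    _ ≤ h * (R / h) + 2 * h := by
        have a1 := indirectUtility_add_le hq hb (n * h) hh.le
        have a2 : u 0 ≤ u 1 := indirectUtility_mono hq hb (by push_cast; linarith)
        have e1 : (n : ℝ) * h + h = (n + 1 : ℕ) * h := by push_cast; ring
        rw [e1] at a1
        have a3 : (u (n + 1) - u n) - (u 1 - u 0) ≤ h := by
          simp only [hu] at a2 ⊢
          linarith
        gcongr
    _ = R + ε := by
        rw [hhdef]
        field_simp

end Screening

/-- A bounded nonnegative atomless value admits an optimal posted price. -/
lemma exists_optimal_postedPrice {Ω : Type*} {mΩ : MeasurableSpace Ω} {P : Measure Ω}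
    [IsProbabilityMeasure P] {T : Ω → ℝ} (hT : Measurable T) {C : ℝ}
    (hTC : ∀ᵐ ω ∂P, 0 ≤ T ω ∧ T ω ≤ C) (hatom : ∀ c, ∀ᵐ ω ∂P, T ω ≠ c) :
    ∃ π : ℝ, ∀ s, 0 ≤ s → s * P.real {ω | s ≤ T ω} ≤ π * P.real {ω | π ≤ T ω} := by
  have hC : 0 ≤ C := by
    obtain ⟨ω, h1, h2⟩ := hTC.exists
    exact h1.trans h2
  have hreal : ∀ s, P.real {ω | s ≤ T ω} = ∫ ω, (if s ≤ T ω then (1 : ℝ) else 0) ∂P := fun s => by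
    rw [← integral_indicator_one (measurableSet_le measurable_const hT)]
    congr 1
  have hcont : Continuous fun s => s * P.real {ω | s ≤ T ω} := by
    refine continuous_id.mul (continuous_iff_continuousAt.2 fun s₀ => ?_)
    simp only [hreal]
    refine continuousAt_of_dominated (bound := fun _ => 1) (Filter.Eventually.of_forall fun s => ?_)
      (Filter.Eventually.of_forall fun s => ae_of_all _ fun ω => ?_) (integrable_const _) ?_
    · exact (Measurable.ite (measurableSet_le measurable_const hT) measurable_const
        measurable_const).aestronglyMeasurable
    · split_ifs <;> simp
    -- Off the null event T = s₀ the indicator is constant for s near s₀; this is where the absence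
    -- of atoms gives continuity of demand.
    · filter_upwards [hatom s₀] with ω hω
      rcases lt_or_gt_of_ne hω with h | h
      · refine (continuousAt_const (y := (0 : ℝ))).congr ?_
        filter_upwards [lt_mem_nhds h] with s hs
        rw [if_neg (not_le.2 hs)]
      · refine (continuousAt_const (y := (1 : ℝ))).congr ?_
        filter_upwards [gt_mem_nhds h] with s hs
        rw [if_pos hs.le]
  obtain ⟨π, -, hπ⟩ := (isCompact_Icc (a := (0 : ℝ)) (b := C)).exists_isMaxOn
    ⟨0, le_rfl, hC⟩ hcont.continuousOn
  refine ⟨π, fun s hs => ?_⟩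
  rcases le_or_gt s C with hsC | hsC
  · exact hπ ⟨hs, hsC⟩
  -- Prices above C sell with probability 0, hence earn no more than the price 0.
  · have h0 : P.real {ω | s ≤ T ω} = 0 := by
      rw [measureReal_eq_zero_iff, measure_eq_zero_iff_ae_notMem]
      filter_upwards [hTC] with ω hω
      simpa using hω.2.trans_lt hsC
    rw [h0, mul_zero]
    simpa using hπ ⟨le_rfl, hC⟩

/-! ### The seller -/

lemma allocProb_mem_Icc {K : ℕ} (w : Lottery K) (k : Fin K) :
    allocProb w k ∈ Set.Icc (0 : ℝ) 1 := by
  constructor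
  · exact Finset.sum_nonneg fun B _ => by split_ifs <;> [exact w.2.1 B; exact le_rfl]
  · rw [← w.2.2]
    exact Finset.sum_le_sum fun B _ => by split_ifs <;> [exact le_rfl; exact w.2.1 B]

lemma allocProb_sureBundle {K : ℕ} (B : Finset (Fin K)) (k : Fin K) :
    allocProb (sureBundle B) k = if k ∈ B then 1 else 0 := by
  rw [allocProb, Finset.sum_eq_single B]
  · simp [sureBundle]
  · intro B' _ hB'
    simp [sureBundle, hB']
  · simp

lemma utility_pureBundling {K : ℕ} (π : ℝ) (θ : Fin K → ℝ) (b : Bool) :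
    (pureBundling K π).utility θ b = if b then ∑ k, θ k - π else 0 := by
  cases b <;> simp [Mechanism.utility, pureBundling, allocProb_sureBundle]

variable {K : ℕ} {F : Measure (Values K)}

/-- Against a buyer whose type is proportional to the value of the grand bundle, no mechanism
yields more than the best posted price for the grand bundle. -/
lemma profits_learnGrandBundle_le [IsProbabilityMeasure F] {w : Fin K → ℝ} {C : ℝ}
    (hw : ∀ k, 0 ≤ w k) (hw1 : ∑ k, w k = 1)
    (hθ : ∀ᵐ v ∂F, ∀ k,
      buyerType F (learnGrandBundle K) v k = w k * linearSignal (fun _ => 1) v)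
    (hTC : ∀ᵐ v ∂F, 0 ≤ linearSignal (fun _ => 1) v ∧ linearSignal (fun _ => 1) v ≤ C) {R : ℝ}
    (hR : ∀ s, 0 ≤ s → s * F.real {v | s ≤ linearSignal (fun _ => 1) v} ≤ R)
    (S : Mechanism K) {R' : ℝ} (hR' : R' ∈ profits F (learnGrandBundle K) S) : R' ≤ R := by
  obtain ⟨r, ⟨hint, hopt⟩, rfl⟩ := hR'
  obtain ⟨m₀, -, hm₀⟩ := S.exists_outside
  have : Nonempty S.M := ⟨m₀⟩
  -- The w-average of the allocation probabilities acts as the probability of selling one good of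
  -- value T. It lies in [0, 1] because w is a probability vector.
  refine integral_payment_le (q := fun m => ∑ k, w k * allocProb (S.x m) k) (p := S.p)
    (measurable_linearSignal fun _ => 1) hTC (fun m => ⟨?_, ?_⟩) ⟨m₀, hm₀⟩ hint ?_ hR
  · exact Finset.sum_nonneg fun k _ => mul_nonneg (hw k) (allocProb_mem_Icc _ k).1
  · rw [← hw1]
    exact Finset.sum_le_sum fun k _ => mul_le_of_le_one_right (hw k) (allocProb_mem_Icc _ k).2
  · filter_upwards [hopt, hθ] with v hv hθv m
    have hu : ∀ m, S.utility (buyerType F (learnGrandBundle K) v) m =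
        linearSignal (fun _ => 1) v * (∑ k, w k * allocProb (S.x m) k) - S.p m := fun m => by
      rw [Mechanism.utility, Finset.mul_sum]
      congr 1
      refine Finset.sum_congr rfl fun k _ => ?_
      rw [hθv k]
      ring
    rw [← hu, ← hu]
    exact hv m

/-- The bound is attained by the report that buys whenever T ≥ π; a buyer indifferent at T = π buys,
as favours the seller when π ≥ 0. -/
lemma postedPrice_mem_profits [IsProbabilityMeasure F]
    (hθ : ∀ᵐ v ∂F, ∑ k, buyerType F (learnGrandBundle K) v k = linearSignal (fun _ => 1) v)
    (π : ℝ) :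
    π * F.real {v | π ≤ linearSignal (fun _ => 1) v} ∈
      profits F (learnGrandBundle K) (pureBundling K π) := by
  classical
  have hset : MeasurableSet {v : Values K | π ≤ linearSignal (fun _ => 1) v} :=
    measurableSet_le measurable_const (measurable_linearSignal _)
  have hpay : ∀ v : Values K,
      (pureBundling K π).p (decide (π ≤ signals (learnGrandBundle K) v 0)) =
        {v : Values K | π ≤ linearSignal (fun _ => 1) v}.indicator (fun _ => π) v := fun v => by
    have : signals (learnGrandBundle K) v 0 = linearSignal (fun _ => 1) v := rfl
    simp [pureBundling, Set.indicator_apply, this]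
  refine ⟨fun s => decide (π ≤ s 0), ⟨?_, ?_⟩, ?_⟩
  · simp only [hpay]
    exact (integrable_const _).indicator hset
  · filter_upwards [hθ] with v hv m
    have : signals (learnGrandBundle K) v 0 = linearSignal (fun _ => 1) v := rfl
    have hu := utility_pureBundling π (buyerType F (learnGrandBundle K) v)
    rw [hv] at hu
    refine (hu m).trans_le (le_of_le_of_eq ?_ (hu _).symm)
    rw [this]
    cases m <;> by_cases h : π ≤ linearSignal (fun _ => 1) v <;> simp [h] <;> linarith
  · simp only [hpay]
    rw [integral_indicator_const _ hset, smul_eq_mul, mul_comm]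

/-! ### The buyer -/

lemma buyerPayoff_pureBundling {n : ℕ} (α : Fin n → Fin K → ℝ) (π : ℝ) :
    buyerPayoff F α (pureBundling K π) =
      ∫⁻ v, ENNReal.ofReal (∑ k, buyerType F α v k - π) ∂F := by
  refine lintegral_congr fun v => ?_
  change (⨆ m : Bool, ENNReal.ofReal ((pureBundling K π).utility (buyerType F α v) m)) = _
  rw [iSup_bool_eq, utility_pureBundling, utility_pureBundling]
  simp

lemma sum_buyerType_ae_eq (hm : ∀ k, Integrable (fun v : Values K => v k) F) {n : ℕ}
    (α : Fin n → Fin K → ℝ) :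
    (fun v => ∑ k, buyerType F α v k) =ᵐ[F]
      F[linearSignal (fun _ => 1) | MeasurableSpace.comap (signals α) inferInstance] := by
  have h : (linearSignal (fun _ => 1) : Values K → ℝ) = ∑ k, fun v : Values K => v k := by
    ext v
    simp [linearSignal]
  rw [h]
  filter_upwards [condExp_finsetSum (fun k _ => hm k) (s := Finset.univ)
    (MeasurableSpace.comap (signals α) inferInstance)] with v hv
  rw [hv, Finset.sum_apply]
  rfl

/-- Against pure bundling, no learning strategy beats knowing the value of the grand bundle. -/
lemma buyerPayoff_pureBundling_le [IsProbabilityMeasure F]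
    (hm : ∀ k, Integrable (fun v : Values K => v k) F) {n : ℕ}
    (α : Fin n → Fin K → ℝ) (π : ℝ) :
    buyerPayoff F α (pureBundling K π) ≤
      ∫⁻ v, ENNReal.ofReal (linearSignal (fun _ => 1) v - π) ∂F := by
  set T : Values K → ℝ := linearSignal (fun _ => 1) with hT
  have hTi : Integrable T F := by
    have h : T = fun v => ∑ k, v k := by ext v; simp [hT, linearSignal]
    rw [h]
    exact integrable_finsetSum _ fun k _ => hm k
  set σ := MeasurableSpace.comap (signals α : Values K → _) inferInstance with hσ
  have hσle := (measurable_signals α).comap_le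
  have hTπ : Integrable (fun v => T v - π) F := hTi.sub (integrable_const _)
  have hpos : Integrable (fun v => max (T v - π) 0) F := hTπ.pos_part
  -- Conditional Jensen for the positive part: the right-hand side dominates E[T - π | σ] and, by
  -- `h2`, also 0.
  have h1 : F[fun v => T v - π | σ] ≤ᵐ[F] F[fun v => max (T v - π) 0 | σ] :=
    condExp_mono hTπ hpos (ae_of_all _ fun v => le_max_left _ _)
  have h2 : 0 ≤ᵐ[F] F[fun v => max (T v - π) 0 | σ] :=
    condExp_nonneg (ae_of_all _ fun v => le_max_right _ _)
  have h3 : F[fun v => T v - π | σ] =ᵐ[F] F[T | σ] - F[fun _ => π | σ] :=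
    condExp_sub hTi (integrable_const _) σ
  rw [condExp_const hσle] at h3
  rw [buyerPayoff_pureBundling]
  calc ∫⁻ v, ENNReal.ofReal (∑ k, buyerType F α v k - π) ∂F
      ≤ ∫⁻ v, ENNReal.ofReal (F[fun v => max (T v - π) 0 | σ] v) ∂F := by
        refine lintegral_mono_ae ?_
        filter_upwards [h1, h3, sum_buyerType_ae_eq hm α] with v h1 h3 h4
        refine ENNReal.ofReal_le_ofReal ?_
        rw [h4]
        exact h3.symm.le.trans h1
    _ = ∫⁻ v, ENNReal.ofReal (max (T v - π) 0) ∂F := by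
        rw [← ofReal_integral_eq_lintegral_ofReal integrable_condExp h2, integral_condExp hσle,
          ofReal_integral_eq_lintegral_ofReal hpos (ae_of_all _ fun v => le_max_right _ _)]
    _ = ∫⁻ v, ENNReal.ofReal (T v - π) ∂F := by
        refine lintegral_congr fun v => ?_
        rcases le_total (T v - π) 0 with h | h
        · simp [max_eq_right h, ENNReal.ofReal_of_nonpos h]
        · rw [max_eq_left h]

end Bundling

end

theorem mainTheorem11 (K : ℕ) (hK : 1 ≤ K) (F : Measure (Bundling.Values K)) (ρ : ℝ)
    (hF : Bundling.IsPrior F ρ)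
    (hμ : ∀ i j : Fin K, i ≠ j →
      Bundling.mean F i =
        (Bundling.stdDev F i ^ 2
            + ρ * Bundling.stdDev F i * ∑ k ∈ Finset.univ.erase i, Bundling.stdDev F k) /
          (Bundling.stdDev F j ^ 2
            + ρ * Bundling.stdDev F j * ∑ k ∈ Finset.univ.erase j, Bundling.stdDev F k) *
        Bundling.mean F j) :
    Bundling.IsVertical F (fun _ => 1) ∧
    ∃ π : ℝ, ∀ N : ℕ, 1 ≤ N →
      Bundling.IsEquilibrium F N (Bundling.learnGrandBundle K) (Bundling.pureBundling K π) := by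
  open Bundling in
  have := hF.isProbabilityMeasure
  have hD := hF.density
  have halign := hF.sum_mean_mul_covariance hμ
  have hm : ∀ k, Integrable (fun v : Values K => v k) F := fun k =>
    (hD.memLp_apply k).integrable (by norm_num)
  have hsum : 0 < ∑ i, mean F i :=
    Finset.sum_pos (fun i _ => hD.mean_pos i) ⟨⟨0, hK⟩, Finset.mem_univ _⟩
  have hw : ∀ k, 0 ≤ mean F k / ∑ i, mean F i := fun k => div_nonneg (hD.mean_pos k).le hsum.le
  have hw1 : ∑ k, mean F k / ∑ i, mean F i = 1 := by rw [← Finset.sum_div, div_self hsum.ne']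
  have hθ := ae_all_iff.2 fun k => hF.buyerType_learnGrandBundle halign k
  have hθsum : ∀ᵐ v ∂F,
      ∑ k, buyerType F (learnGrandBundle K) v k = linearSignal (fun _ => 1) v := by
    filter_upwards [hθ] with v hv
    simp only [hv]
    rw [← Finset.sum_mul, hw1, one_mul]
  obtain ⟨C, hC⟩ := hD.exists_ae_mem
  have hTC : ∀ᵐ v ∂F, 0 ≤ linearSignal (fun _ => 1) v ∧
      linearSignal (fun _ => 1) v ≤ ∑ _k : Fin K, C := by
    filter_upwards [hC] with v hv
    simp only [linearSignal, one_mul]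
    exact ⟨Finset.sum_nonneg fun k _ => (hv k).1, Finset.sum_le_sum fun k _ => (hv k).2⟩
  have hone : (fun _ : Fin K => (1 : ℝ)) ≠ 0 := fun h => by simpa using congrFun h ⟨0, hK⟩
  obtain ⟨π, hπ⟩ := exists_optimal_postedPrice (measurable_linearSignal fun _ => 1) hTC
    (hD.measure_linearSignal_eq hone)
  refine ⟨hF.isVertical_bundle halign, π, fun N hN => ⟨hN, fun n' _ α' => ?_, ?_⟩⟩
  -- Learning T attains the Jensen bound, since then the types sum to T itself.
  · refine (buyerPayoff_pureBundling_le hm α' π).trans_eq ?_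
    rw [buyerPayoff_pureBundling]
    refine lintegral_congr_ae ?_
    filter_upwards [hθsum] with v hv
    rw [hv]
  · have hle := fun (S : Mechanism K) (R' : ℝ) (hR' : R' ∈ profits F (learnGrandBundle K) S) =>
      profits_learnGrandBundle_le hw hw1 hθ hTC hπ S hR'
    exact ⟨_, ⟨postedPrice_mem_profits hθsum π, fun R' hR' => hle _ R' hR'⟩, hle⟩
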